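/- Let $L=\sum_{n=1}^N \lambda_n v_n v_n^\top$ be an orthonormal eigendecomposition of a real symmetric positive semidefinite $N\times N$ matrix $L$ ($v_1,\dots,v_N$ orthonormal in $\mathbb R^N$). For $Y\subseteq\{1,\dots,N\}$ write $L_Y=[L_{ij}]_{i,j\in Y}$, with $\det L_\emptyset=1$, and $P_L(Y)=\det(L_Y)/\det(L+I)$. Let $e_i$ be the $i$-th standard basis vector. Consider the following algorithm. Phase one: start with $J=\emptyset$ and, for $n=1,\dots,N$, put $n$ into $J$, independently of the other indices, with probability $\frac{\lambda_n}{\lambda_n+1}$. Set $V=\{v_n : n\in J\}$ and $Y=\emptyset$. Phase two: while $|V|>0$, select an item $i\in\{1,\dots,N\}$ with probability $\frac1{|V|}\sum_{v\in V}(v^\top e_i)^2$ (given $V$, independently of the past), replace $Y$ by $Y\cup\{i\}$, and replace $V$ by an orthonormal basis $V_\perp$ of the subspace of $\operatorname{span}V$ orthogonal to $e_i$. Here $V_\perp$ is computed from $V$ and $i$ by an arbitrary fixed rule. Output: $Y$. Then, whatever rule is used for $V_\perp$: 1. the loop of phase two stops after at most $N$ passes; 2. for every $Y\subseteq\{1,\dots,N\}$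 the algorithm outputs $Y$ with probability exactly $P_L(Y)$, and $P_L(Y)\ge 0$; 3. the cardinality of the output is distributed as $B_1+\dots+B_N$, where $B_1,\dots,B_N$ are independent Bernoulli variables with $\Pr(B_n=1)=\frac{\lambda_n}{\lambda_n+1}$. -/

import Mathlib

open scoped ENNReal NNReal

noncomputable section

namespace DPP

/-- The principal submatrix `L_Y = [L_ij]_{i,j ∈ Y}`. -/
def principal {N : ℕ} (L : Matrix (Fin N) (Fin N) ℝ) (Y : Finset (Fin N)) : Matrix Y Y ℝ :=
  L.submatrix Subtype.val Subtype.val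

/-- The probability that the L-ensemble with kernel `L` assigns to the set `Y`. -/
def lEnsembleProb {N : ℕ} (L : Matrix (Fin N) (Fin N) ℝ) (Y : Finset (Fin N)) : ℝ :=
  (principal L Y).det / (L + 1).det

/-- `L = ∑ n, lam n • v n (v n)ᵀ` with `v` orthonormal. -/
structure IsEigendecomposition {N : ℕ} (L : Matrix (Fin N) (Fin N) ℝ)
    (lam : Fin N → ℝ) (v : Fin N → EuclideanSpace ℝ (Fin N)) : Prop where
  orthonormal : Orthonormal ℝ v
  eq_sum : L = ∑ n, lam n • Matrix.vecMulVec (v n) (v n)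

/-- The eigenvalues of a positive semidefinite matrix are nonnegative. -/
theorem IsEigendecomposition.nonneg {N : ℕ} {L : Matrix (Fin N) (Fin N) ℝ}
    {lam : Fin N → ℝ} {v : Fin N → EuclideanSpace ℝ (Fin N)}
    (h : IsEigendecomposition L lam v) (hL : L.PosSemidef) (n : Fin N) : 0 ≤ lam n := by
  have hd : ∀ m, (v m).ofLp ⬝ᵥ (v n).ofLp = if m = n then 1 else 0 := by
    intro m
    have := (orthonormal_iff_ite.mp h.orthonormal) n m
    rw [EuclideanSpace.inner_eq_star_dotProduct] at this
    simpa [eq_comm] using this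
  have h1 : (0 : ℝ) ≤ (v n).ofLp ⬝ᵥ (L.mulVec (v n).ofLp) := by
    simpa using hL.dotProduct_mulVec_nonneg (v n).ofLp
  rw [h.eq_sum, Matrix.sum_mulVec] at h1
  simpa [Matrix.smul_mulVec, Matrix.vecMulVec_mulVec, hd, dotProduct_smul] using h1

/-! ### First phase -/

/-- A coin that shows `true` with probability `x / (x + 1)`: a Bernoulli variable. -/
def coin (x : ℝ) (hx : 0 ≤ x) : PMF Bool :=
  PMF.ofFintype
    (fun b => if b then ENNReal.ofReal (x / (x + 1)) else ENNReal.ofReal (1 - x / (x + 1))) (by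
      have h : x / (x + 1) ≤ 1 := div_le_one_of_le₀ (by linarith) (by linarith)
      rw [Fintype.sum_bool, if_pos rfl, if_neg Bool.false_ne_true,
        ← ENNReal.ofReal_add (by positivity) (by linarith)]
      simp)

/-- The loop "for `n` in the list, put `n` into `J` if the `n`-th (fresh) coin shows `true`",
started with the set `J`. -/
def firstLoop {N : ℕ} (c : Fin N → PMF Bool) :
    List (Fin N) → Finset (Fin N) → PMF (Finset (Fin N))
  | [], J => PMF.pure J
  | n :: ns, J => (c n).bind fun b => firstLoop c ns (if b then insert n J else J)

/-- The first phase: the random set `J` of indices of selected eigenvectors. -/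
def phaseOne {N : ℕ} (lam : Fin N → ℝ) (hlam : ∀ n, 0 ≤ lam n) : PMF (Finset (Fin N)) :=
  firstLoop (fun n => coin (lam n) (hlam n)) (List.finRange N) ∅

/-! ### Second phase -/

/-- Finite orthonormal sets of vectors of `ℝ^N`. -/
def OrthonormalSet (N : ℕ) : Type :=
  {V : Finset (EuclideanSpace ℝ (Fin N)) //
    Orthonormal ℝ (Subtype.val : V → EuclideanSpace ℝ (Fin N))}

/-- The set `{v n | n ∈ J}` for an orthonormal family `v`. -/
def selectedVectors {N : ℕ} (v : Fin N → EuclideanSpace ℝ (Fin N)) (hv : Orthonormal ℝ v)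
    (J : Finset (Fin N)) : OrthonormalSet N :=
  ⟨J.map ⟨v, hv.linearIndependent.injective⟩, by
    have h := hv.toSubtypeRange
    rw [orthonormal_subtype_iff_ite] at h
    refine orthonormal_subtype_iff_ite.mpr fun x hx y hy => h x ?_ y ?_
    · obtain ⟨n, -, rfl⟩ := Finset.mem_map.mp hx; exact ⟨n, rfl⟩
    · obtain ⟨n, -, rfl⟩ := Finset.mem_map.mp hy; exact ⟨n, rfl⟩⟩

/-- The probability `(1 / |V|) ∑_{u ∈ V} (uᵀ e_i)²` of selecting the item `i`. -/
def selectProb {N : ℕ} (V : OrthonormalSet N) (i : Fin N) : ℝ :=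
  1 / (V.1.card : ℝ) * ∑ u ∈ V.1, (inner ℝ u (EuclideanSpace.single i (1 : ℝ))) ^ 2

theorem selectProb_nonneg {N : ℕ} (V : OrthonormalSet N) (i : Fin N) : 0 ≤ selectProb V i := by
  unfold selectProb; positivity

theorem sum_selectProb {N : ℕ} (V : OrthonormalSet N) (hV : 0 < V.1.card) :
    ∑ i, selectProb V i = 1 := by
  unfold selectProb
  rw [← Finset.mul_sum, Finset.sum_comm]
  have h : ∀ u ∈ V.1, ∑ i, (inner ℝ u (EuclideanSpace.single i (1 : ℝ))) ^ 2 = 1 := by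
    intro u hu
    have h1 : ‖u‖ = 1 := V.2.1 ⟨u, hu⟩
    have h2 := EuclideanSpace.real_norm_sq_eq u
    rw [h1] at h2
    simpa [EuclideanSpace.inner_single_right] using h2.symm
  rw [Finset.sum_congr rfl h]
  have : (V.1.card : ℝ) ≠ 0 := by positivity
  simp [this]

/-- The law of the item selected when the current orthonormal set is `V`. -/
def selectItem {N : ℕ} (V : OrthonormalSet N) (hV : 0 < V.1.card) : PMF (Fin N) :=
  PMF.ofFintype (fun i => ENNReal.ofReal (selectProb V i)) (by
    rw [← ENNReal.ofReal_sum_of_nonneg fun i _ => selectProb_nonneg V i, sum_selectProb V hV,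
      ENNReal.ofReal_one])

/-- `perp` computes, from `V` and `i`, some orthonormal basis of the subspace of `span V`
orthogonal to `e_i`. -/
def IsPerpRule {N : ℕ} (perp : OrthonormalSet N → Fin N → OrthonormalSet N) : Prop :=
  ∀ V i, Submodule.span ℝ ((perp V i).1 : Set (EuclideanSpace ℝ (Fin N))) =
    Submodule.span ℝ (V.1 : Set (EuclideanSpace ℝ (Fin N))) ⊓
      (Submodule.span ℝ {EuclideanSpace.single i (1 : ℝ)})ᗮ

/-- The variables of the second phase. -/
structure State (N : ℕ) where
  V : OrthonormalSet N
  Y : Finset (Fin N)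

/-- One pass through the loop "while `|V| > 0`": select `i`, put it into `Y`, replace `V` by
`perp V i`. A state with `|V| = 0` is final and does not change any more. -/
def loopStep {N : ℕ} (perp : OrthonormalSet N → Fin N → OrthonormalSet N) (s : State N) :
    PMF (State N) :=
  if h : 0 < s.V.1.card then (selectItem s.V h).map fun i => ⟨perp s.V i, insert i s.Y⟩
  else PMF.pure s

/-- The law of the state after (at most) `t` passes through the loop, started in a given state. -/
def runLoop {N : ℕ} (perp : OrthonormalSet N → Fin N → OrthonormalSet N) :
    ℕ → State N → PMF (State N)
  | 0, s => PMF.pure s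
  | t + 1, s => (loopStep perp s).bind (runLoop perp t)

/-- The law of the state of the whole algorithm when the first phase has been followed by
(at most) `t` passes through the loop of the second phase. -/
def stateAfter {N : ℕ} (lam : Fin N → ℝ) (hlam : ∀ n, 0 ≤ lam n)
    (v : Fin N → EuclideanSpace ℝ (Fin N)) (hv : Orthonormal ℝ v)
    (perp : OrthonormalSet N → Fin N → OrthonormalSet N) (t : ℕ) : PMF (State N) :=
  (phaseOne lam hlam).bind fun J => runLoop perp t ⟨selectedVectors v hv J, ∅⟩

/-- The probability that the algorithm stops and outputs `Y`: the (increasing) limit of the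
probabilities that it has stopped with output `Y` after at most `t` passes. -/
def outputProb {N : ℕ} (lam : Fin N → ℝ) (hlam : ∀ n, 0 ≤ lam n)
    (v : Fin N → EuclideanSpace ℝ (Fin N)) (hv : Orthonormal ℝ v)
    (perp : OrthonormalSet N → Fin N → OrthonormalSet N) (Y : Finset (Fin N)) : ℝ≥0∞ :=
  ⨆ t : ℕ, (stateAfter lam hlam v hv perp t).toOuterMeasure {s | s.V.1.card = 0 ∧ s.Y = Y}

end DPP

end

namespace DPP

open Finset Matrix

variable {N : ℕ}

/-! ### The projection kernel of an orthonormal set -/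

/-! Let `K` be the matrix of the orthogonal projection onto the span of `V`. The law of the output
of phase two depends on `V` only through `K`: the item `i` is selected with probability `K i i /
|V|`, and passing to `V_⊥` replaces `K` by its Schur complement `K'` at `i` (`kernel_perp`),
whatever basis the rule returns. Hence `K i i * det K'_{A \ i} = det K_A` for `i ∈ A`
(`det_kernel_insert`). By induction each of the `|A| = |V|` choices of the first item of `A`
contributes `det K_A / |V|`, so the loop adds exactly `A` with probability `det K_A`
(`runLoop_stopped`). Since `|V|` is the trace of `K` and drops by one in each pass, at most `N`
passes occur.

Phase one picks `J` with probability `∏_{n ∈ J} λ_n / ∏_n (λ_n + 1)`. The output law is therefore a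
mixture of minors of the projections for the sets `J` with `|J| = |Y|`; a Cauchy-Binet identity
(`det_principal_eq_sum`) sums the numerators to `det L_Y`, and the common denominator is `det (L +
I)`. Phase two adds exactly `|J|` items, so the output size is the number of successful coins. -/

/-- The linear span of an orthonormal set. -/
abbrev OrthonormalSet.span (V : OrthonormalSet N) : Submodule ℝ (EuclideanSpace ℝ (Fin N)) :=
  Submodule.span ℝ (V.1 : Set (EuclideanSpace ℝ (Fin N)))

/-- The matrix `∑ u ∈ V, u uᵀ` of the orthogonal projection onto the span of `V`. -/
noncomputable def OrthonormalSet.kernel (V : OrthonormalSet N) : Matrix (Fin N) (Fin N) ℝ :=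
  ∑ u ∈ V.1, vecMulVec u u

theorem kernel_apply (V : OrthonormalSet N) (i j : Fin N) :
    V.kernel i j = ∑ u ∈ V.1, u i * u j := by
  simp [OrthonormalSet.kernel, Matrix.sum_apply, vecMulVec_apply]

theorem kernel_comm (V : OrthonormalSet N) (i j : Fin N) : V.kernel i j = V.kernel j i := by
  simp only [kernel_apply, mul_comm]

theorem posSemidef_kernel (V : OrthonormalSet N) : V.kernel.PosSemidef :=
  posSemidef_sum _ fun u _ => by simpa using posSemidef_vecMulVec_self_star (u : Fin N → ℝ)

theorem starProjection_span (V : OrthonormalSet N) (x : EuclideanSpace ℝ (Fin N)) :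
    V.span.starProjection x = ∑ u ∈ V.1, inner ℝ u x • u := by
  refine Submodule.eq_starProjection_of_mem_orthogonal ?_ ?_
  · exact Submodule.sum_mem _ fun u hu => Submodule.smul_mem _ _ (Submodule.subset_span hu)
  · rw [Submodule.mem_orthogonal]
    intro w hw
    induction hw using Submodule.span_induction with
    | mem w hw =>
      have h := orthonormal_subtype_iff_ite.mp V.2 w hw
      rw [inner_sub_right, inner_sum, Finset.sum_congr rfl (g := fun u => if w = u then inner ℝ w x else 0)]
      · rw [Finset.sum_ite_eq, if_pos (by exact hw), sub_self]
      · intro u hu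
        rw [inner_smul_right, h u hu]
        split_ifs with e <;> simp [e]
    | zero => simp
    | add a b _ _ ha hb => rw [inner_add_left, ha, hb, add_zero]
    | smul c a _ ha => rw [inner_smul_left, ha, mul_zero]

theorem starProjection_single (V : OrthonormalSet N) (i j : Fin N) :
    V.span.starProjection (EuclideanSpace.single j (1 : ℝ)) i = V.kernel i j := by
  simp [starProjection_span, kernel_apply, EuclideanSpace.inner_single_right, mul_comm]

theorem norm_starProjection_single_sq (V : OrthonormalSet N) (i : Fin N) :
    ‖V.span.starProjection (EuclideanSpace.single i (1 : ℝ))‖ ^ 2 = V.kernel i i := by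
  rw [← starProjection_single, ← real_inner_self_eq_norm_sq,
    Submodule.inner_starProjection_left_eq_right, Submodule.starProjection_eq_self_iff.mpr
      (Submodule.starProjection_apply_mem _ _)]
  simp [EuclideanSpace.inner_single_left]

/-- Projecting onto the part of `W` orthogonal to `e` removes the direction of the projection
of `e` onto `W`. -/
theorem starProjection_inf_orthogonal_singleton {E : Type*} [NormedAddCommGroup E]
    [InnerProductSpace ℝ E] [FiniteDimensional ℝ E] (W : Submodule ℝ E) (e x : E) :
    (W ⊓ (Submodule.span ℝ {e})ᗮ).starProjection x =
      W.starProjection x -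
        (inner ℝ (W.starProjection e) x / ‖W.starProjection e‖ ^ 2) • W.starProjection e := by
  have hinner : ∀ w ∈ W, inner ℝ (W.starProjection e) w = inner ℝ e w := fun w hw => by
    rw [Submodule.inner_starProjection_left_eq_right, Submodule.starProjection_eq_self_iff.mpr hw]
  have hpx : inner ℝ (W.starProjection e) x = inner ℝ e (W.starProjection x) :=
    Submodule.inner_starProjection_left_eq_right _ _ _
  have hpp : inner ℝ e (W.starProjection e) = ‖W.starProjection e‖ ^ 2 := by
    rw [← hinner _ (Submodule.starProjection_apply_mem _ _), real_inner_self_eq_norm_sq]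
  refine Submodule.eq_starProjection_of_mem_of_inner_eq_zero ?_ ?_
  · refine ⟨sub_mem (Submodule.starProjection_apply_mem _ _)
      (Submodule.smul_mem _ _ (Submodule.starProjection_apply_mem _ _)), ?_⟩
    rw [SetLike.mem_coe, Submodule.mem_orthogonal_singleton_iff_inner_right, inner_sub_right,
      inner_smul_right, hpp, hpx]
    -- If `e` is orthogonal to `W`, the coefficient is `0 / 0 = 0`, and nothing has to be removed.
    by_cases h0 : W.starProjection e = 0
    · rw [h0] at hpp hpx
      simp [h0, ← hpx]
    · rw [div_mul_cancel₀ _ (by positivity), sub_self]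
  · rintro w ⟨hw, hwe⟩
    rw [SetLike.mem_coe, Submodule.mem_orthogonal_singleton_iff_inner_right] at hwe
    have h1 : inner ℝ (x - W.starProjection x) w = 0 :=
      Submodule.starProjection_inner_eq_zero _ _ hw
    rw [sub_sub_eq_add_sub, add_sub_right_comm, inner_add_left, h1, inner_smul_left, hinner w hw,
      hwe]
    simp

/-- A projection depends only on its subspace, so the choice of the basis `perp V i` disappears
here. This is the only place where the rule itself is analysed. -/
theorem kernel_perp {perp : OrthonormalSet N → Fin N → OrthonormalSet N} (hperp : IsPerpRule perp)
    (V : OrthonormalSet N) (i a b : Fin N) :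
    (perp V i).kernel a b = V.kernel a b - V.kernel a i * V.kernel i b / V.kernel i i := by
  have h := starProjection_inf_orthogonal_singleton V.span (EuclideanSpace.single i (1 : ℝ))
    (EuclideanSpace.single b (1 : ℝ))
  rw [← starProjection_single]
  simp only [hperp V i]
  rw [h, norm_starProjection_single_sq, EuclideanSpace.inner_single_right]
  simp only [PiLp.sub_apply, PiLp.smul_apply, starProjection_single, smul_eq_mul]
  rw [kernel_comm V i b]
  simp
  ring

theorem trace_kernel (V : OrthonormalSet N) : V.kernel.trace = V.1.card := by
  have h : ∀ u ∈ V.1, (vecMulVec (u : Fin N → ℝ) u).trace = 1 := fun u hu => by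
    have h1 : ‖u‖ = 1 := V.2.1 ⟨u, hu⟩
    have h2 := EuclideanSpace.real_norm_sq_eq u
    rw [h1] at h2
    simpa [trace_vecMulVec, dotProduct, sq] using h2.symm
  rw [OrthonormalSet.kernel, trace_sum, Finset.sum_congr rfl h]
  simp

theorem sum_kernel_mul_kernel (V : OrthonormalSet N) (i : Fin N) :
    ∑ a, V.kernel a i * V.kernel i a = V.kernel i i := by
  rw [← norm_starProjection_single_sq, EuclideanSpace.real_norm_sq_eq]
  simp only [starProjection_single, sq, kernel_comm V i]

/-- The trace counts the basis vectors, and the rank-one term removed from the kernel has trace `K i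
i / K i i = 1` because `K` is symmetric and idempotent. -/
theorem card_perp {perp : OrthonormalSet N → Fin N → OrthonormalSet N} (hperp : IsPerpRule perp)
    (V : OrthonormalSet N) (i : Fin N) (hi : V.kernel i i ≠ 0) :
    (perp V i).1.card + 1 = V.1.card := by
  have h : ((perp V i).1.card : ℝ) = V.1.card - 1 := by
    rw [← trace_kernel, ← trace_kernel, trace, trace]
    simp only [diag_apply, kernel_perp hperp, Finset.sum_sub_distrib, ← Finset.sum_div,
      sum_kernel_mul_kernel, div_self hi]
  have : ((perp V i).1.card + 1 : ℝ) = V.1.card := by rw [h]; ring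
  exact_mod_cast this

/-- A diagonal entry is the squared norm of the projection of `e_i`; if it vanishes, so does the
whole row. -/
theorem kernel_eq_zero_of_diag (V : OrthonormalSet N) (i j : Fin N) (hi : V.kernel i i = 0) :
    V.kernel i j = 0 := by
  have h := norm_starProjection_single_sq V i
  rw [hi, sq_eq_zero_iff, norm_eq_zero] at h
  rw [kernel_comm, ← starProjection_single, h]
  rfl

theorem selectProb_eq (V : OrthonormalSet N) (i : Fin N) :
    selectProb V i = V.kernel i i / V.1.card := by
  simp [selectProb, kernel_apply, EuclideanSpace.inner_single_right, sq, div_eq_inv_mul]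

/-- Schur complement with respect to a nonzero diagonal entry. -/
theorem det_principal_insert (K : Matrix (Fin N) (Fin N) ℝ) (B : Finset (Fin N)) (i : Fin N)
    (hB : i ∉ B) (hi : K i i ≠ 0) :
    (principal K (insert i B)).det =
      K i i * (principal (of fun a b => K a b - K a i * K i b / K i i) B).det := by
  let e : Unit ⊕ B ≃ (insert i B : Finset (Fin N)) :=
    (Equiv.sumComm _ _).trans ((Equiv.optionEquivSumPUnit _).symm.trans
      (Finset.subtypeInsertEquivOption hB).symm)
  have hl : ∀ u, (e (Sum.inl u) : Fin N) = i := fun u => rfl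
  have hr : ∀ b, (e (Sum.inr b) : Fin N) = b := fun b => rfl
  have hM : (principal K (insert i B)).submatrix e e =
      fromBlocks (K i i • (1 : Matrix Unit Unit ℝ)) (of fun _ (b : B) => K i b)
        (of fun (a : B) _ => K a i)
        (principal K B) := by
    ext (a | a) (b | b) <;> simp [principal, hl, hr]
  let _ : Invertible (K i i • (1 : Matrix Unit Unit ℝ)) :=
    ⟨(K i i)⁻¹ • 1, by simp [smul_smul, hi], by simp [smul_smul, hi]⟩
  rw [← det_submatrix_equiv_self e, hM, det_fromBlocks₁₁]
  congr 1
  · simp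
  · congr 1
    ext a b
    have hinv : ⅟(K i i • (1 : Matrix Unit Unit ℝ)) = (K i i)⁻¹ • 1 := rfl
    rw [hinv]
    simp [principal, Matrix.mul_apply]
    ring

theorem det_kernel_insert {perp : OrthonormalSet N → Fin N → OrthonormalSet N}
    (hperp : IsPerpRule perp) (V : OrthonormalSet N) (B : Finset (Fin N)) (i : Fin N)
    (hB : i ∉ B) (hi : V.kernel i i ≠ 0) :
    (principal V.kernel (insert i B)).det =
      V.kernel i i * (principal (perp V i).kernel B).det := by
  rw [det_principal_insert _ _ _ hB hi]
  congr 2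
  ext a b
  exact (kernel_perp hperp V i a b).symm

theorem det_kernel_eq_zero (V : OrthonormalSet N) (A : Finset (Fin N)) (i : Fin N) (hA : i ∈ A)
    (hi : V.kernel i i = 0) : (principal V.kernel A).det = 0 :=
  det_eq_zero_of_row_eq_zero ⟨i, hA⟩ fun j => kernel_eq_zero_of_diag V i j hi

theorem det_kernel_nonneg (V : OrthonormalSet N) (A : Finset (Fin N)) :
    0 ≤ (principal V.kernel A).det :=
  ((posSemidef_kernel V).submatrix _).det_nonneg

/-! ### The law of the second phase -/

theorem runLoop_of_card_eq_zero (perp : OrthonormalSet N → Fin N → OrthonormalSet N) (t : ℕ)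
    (s : State N) (hs : s.V.1.card = 0) : runLoop perp t s = PMF.pure s := by
  induction t with
  | zero => rfl
  | succ t ih => rw [runLoop, loopStep, dif_neg (by omega), PMF.pure_bind, ih]

theorem runLoop_succ_of_pos (perp : OrthonormalSet N → Fin N → OrthonormalSet N) (t : ℕ)
    (s : State N) (hs : 0 < s.V.1.card) :
    runLoop perp (t + 1) s =
      (selectItem s.V hs).bind fun i => runLoop perp t ⟨perp s.V i, insert i s.Y⟩ := by
  rw [runLoop, loopStep, dif_pos hs, PMF.bind_map]
  rfl

theorem selectItem_apply (V : OrthonormalSet N) (hV : 0 < V.1.card) (i : Fin N) :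
    selectItem V hV i = ENNReal.ofReal (V.kernel i i / V.1.card) := by
  rw [selectItem, PMF.ofFintype_apply, selectProb_eq]

/-- The loop invariant: items already in `Y` are orthogonal to the span of `V`, hence have
probability zero of being selected again. -/
theorem kernel_perp_diag_eq_zero {perp : OrthonormalSet N → Fin N → OrthonormalSet N}
    (hperp : IsPerpRule perp) (V : OrthonormalSet N) (Y : Finset (Fin N))
    (hY : ∀ j ∈ Y, V.kernel j j = 0) (i : Fin N) (hi : V.kernel i i ≠ 0) :
    ∀ j ∈ insert i Y, (perp V i).kernel j j = 0 := by
  intro j hj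
  rw [kernel_perp hperp]
  rcases Finset.mem_insert.mp hj with rfl | hj
  · rw [mul_div_assoc, div_self hi, mul_one, sub_self]
  · simp [hY j hj, kernel_eq_zero_of_diag V j i (hY j hj)]

/-- With at least `|V|` passes, the loop stops, and every pass adds a new item. -/
theorem card_of_mem_support_runLoop {perp : OrthonormalSet N → Fin N → OrthonormalSet N}
    (hperp : IsPerpRule perp) (t : ℕ) (s : State N) (ht : s.V.1.card ≤ t)
    (hY : ∀ j ∈ s.Y, s.V.kernel j j = 0) (r : State N) (hr : r ∈ (runLoop perp t s).support) :
    r.V.1.card = 0 ∧ r.Y.card = s.Y.card + s.V.1.card := by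
  induction t generalizing s with
  | zero =>
    obtain rfl : r = s := by simpa [runLoop] using hr
    omega
  | succ t ih =>
    rcases Nat.eq_zero_or_pos s.V.1.card with h0 | h0
    · rw [runLoop_of_card_eq_zero _ _ _ h0] at hr
      obtain rfl : r = s := by simpa using hr
      omega
    · rw [runLoop_succ_of_pos _ _ _ h0, PMF.mem_support_bind_iff] at hr
      obtain ⟨i, hi, hr⟩ := hr
      have hii : s.V.kernel i i ≠ 0 := by
        intro h
        rw [PMF.mem_support_iff, selectItem_apply, h] at hi
        simp at hi
      have hc := card_perp hperp s.V i hii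
      have hiY : i ∉ s.Y := fun h => hii (hY i h)
      have := ih ⟨perp s.V i, insert i s.Y⟩ (by simp only; omega)
        (kernel_perp_diag_eq_zero hperp s.V s.Y hY i hii) hr
      rw [Finset.card_insert_of_notMem hiY] at this
      simp only at this
      omega

theorem runLoop_stopped_of_card_eq_zero (perp : OrthonormalSet N → Fin N → OrthonormalSet N)
    (Y : Finset (Fin N)) (t : ℕ) (s : State N) (hs : s.V.1.card = 0) :
    (runLoop perp t s).toOuterMeasure {r | r.V.1.card = 0 ∧ r.Y = Y} =
      if s.Y ⊆ Y ∧ (Y \ s.Y).card = s.V.1.card then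
        ENNReal.ofReal (principal s.V.kernel (Y \ s.Y)).det else 0 := by
  rw [runLoop_of_card_eq_zero _ _ _ hs, PMF.toOuterMeasure_pure_apply]
  have hiff : s.Y ⊆ Y ∧ (Y \ s.Y).card = s.V.1.card ↔ s.Y = Y := by
    rw [hs, Finset.card_eq_zero, Finset.sdiff_eq_empty_iff_subset]
    exact ⟨fun h => h.1.antisymm h.2, fun h => by simp [h]⟩
  rw [if_congr hiff rfl rfl]
  by_cases h : s.Y = Y
  · have : IsEmpty (Y \ s.Y : Finset (Fin N)) := by
      rw [h, Finset.sdiff_self]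
      infer_instance
    rw [if_pos ⟨hs, h⟩, if_pos h, det_isEmpty, ENNReal.ofReal_one]
  · rw [if_neg h, if_neg fun h' => h h'.2]

/-- The probability that the loop, started with the kernel `K` of `V`, adds exactly the items of
`Y` is the principal minor of `K` at the new items, provided that there are `|V|` of them. -/
theorem runLoop_stopped {perp : OrthonormalSet N → Fin N → OrthonormalSet N}
    (hperp : IsPerpRule perp) (Y : Finset (Fin N)) (t : ℕ) (s : State N) (ht : s.V.1.card ≤ t)
    (hY : ∀ j ∈ s.Y, s.V.kernel j j = 0) :
    (runLoop perp t s).toOuterMeasure {r | r.V.1.card = 0 ∧ r.Y = Y} =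
      if s.Y ⊆ Y ∧ (Y \ s.Y).card = s.V.1.card then
        ENNReal.ofReal (principal s.V.kernel (Y \ s.Y)).det else 0 := by
  induction t generalizing s with
  | zero =>
    exact runLoop_stopped_of_card_eq_zero perp Y 0 s (by omega)
  | succ t ih =>
    rcases Nat.eq_zero_or_pos s.V.1.card with h0 | h0
    · exact runLoop_stopped_of_card_eq_zero perp Y _ s h0
    have hk : (0 : ℝ) < s.V.1.card := by exact_mod_cast h0
    rw [runLoop_succ_of_pos _ _ _ h0, PMF.toOuterMeasure_bind_apply, tsum_fintype]
    -- The factor `K i i` of the selection probability completes the smaller minor to the full one,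
    -- so the contribution is the same for every new item `i` of `Y`. If `K i i = 0`, both sides
    -- vanish.
    have key : ∀ i, selectItem s.V h0 i *
        (runLoop perp t ⟨perp s.V i, insert i s.Y⟩).toOuterMeasure {r | r.V.1.card = 0 ∧ r.Y = Y} =
        if i ∈ Y \ s.Y then if s.Y ⊆ Y ∧ (Y \ s.Y).card = s.V.1.card then
          ENNReal.ofReal ((principal s.V.kernel (Y \ s.Y)).det / s.V.1.card) else 0 else 0 := by
      intro i
      rw [selectItem_apply]
      by_cases hii : s.V.kernel i i = 0
      · rw [hii, zero_div, ENNReal.ofReal_zero, zero_mul]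
        split_ifs with h1 h2
        · rw [det_kernel_eq_zero s.V _ i h1 hii]; simp
        · rfl
        · rfl
      have hc := card_perp hperp s.V i hii
      have hiY : i ∉ s.Y := fun h => hii (hY i h)
      rw [ih ⟨perp s.V i, insert i s.Y⟩ (by simp only; omega)
        (kernel_perp_diag_eq_zero hperp s.V s.Y hY i hii)]
      simp only [Finset.insert_subset_iff, Finset.mem_sdiff, hiY, not_false_eq_true, and_true]
      by_cases hi : i ∈ Y
      · have hA : i ∈ Y \ s.Y := Finset.mem_sdiff.mpr ⟨hi, hiY⟩
        have he : Y \ insert i s.Y = (Y \ s.Y).erase i := Finset.sdiff_insert _ _ _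
        have hcard := Finset.card_erase_add_one hA
        rw [he]
        have hiff : ((Y \ s.Y).erase i).card = (perp s.V i).1.card ↔
            (Y \ s.Y).card = s.V.1.card := by omega
        simp only [hi, true_and, if_true, hiff]
        split_ifs
        · rw [← ENNReal.ofReal_mul (div_nonneg (posSemidef_kernel s.V).diag_nonneg hk.le)]
          congr 1
          conv_rhs => rw [← Finset.insert_erase hA, det_kernel_insert hperp s.V _ i (by simp) hii]
          ring
        · simp
      · simp [hi]
    rw [Finset.sum_congr rfl fun i _ => key i, Finset.sum_ite_mem, Finset.univ_inter,
      Finset.sum_const]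
    split_ifs with h
    · rw [h.2, nsmul_eq_mul, ← ENNReal.ofReal_natCast, ← ENNReal.ofReal_mul (by positivity),
        mul_div_cancel₀ _ hk.ne']
    · simp

theorem runLoop_mono (perp : OrthonormalSet N → Fin N → OrthonormalSet N) (Y : Finset (Fin N))
    (s : State N) :
    Monotone fun t => (runLoop perp t s).toOuterMeasure {r | r.V.1.card = 0 ∧ r.Y = Y} := by
  refine monotone_nat_of_le_succ fun t => ?_
  induction t generalizing s with
  | zero =>
    by_cases h : s.V.1.card = 0
    · rw [runLoop_of_card_eq_zero _ _ _ h, runLoop_of_card_eq_zero _ _ _ h]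
    · rw [runLoop, PMF.toOuterMeasure_pure_apply, if_neg fun h' => h h'.1]
      exact zero_le
  | succ t ih =>
    rw [runLoop, runLoop, PMF.toOuterMeasure_bind_apply, PMF.toOuterMeasure_bind_apply]
    exact ENNReal.tsum_le_tsum fun r => mul_le_mul_right (ih r) _

/-! ### Principal minors of an eigendecomposition -/

/-- The coefficient of `∏ y, μ (f y)` in the principal minor of `∑ n, μ n • v n (v n)ᵀ`. -/
noncomputable def minorCoeff (v : Fin N → EuclideanSpace ℝ (Fin N)) (Y : Finset (Fin N)) (f : Y → Fin N) : ℝ :=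
  (∏ y, v (f y) y) * (of fun y z : Y => v (f y) z).det

theorem minorCoeff_eq_zero (v : Fin N → EuclideanSpace ℝ (Fin N)) (Y : Finset (Fin N))
    (f : Y → Fin N) (hf : ¬ Function.Injective f) : minorCoeff v Y f = 0 := by
  obtain ⟨a, b, hab, hne⟩ : ∃ a b, f a = f b ∧ a ≠ b := by
    simpa [Function.Injective] using hf
  rw [minorCoeff, det_zero_of_row_eq hne, mul_zero]
  ext z
  simp [hab]

/-- Row `y` of the minor is a combination of the restrictions of the `v n` to `Y`; the determinant
is expanded by multilinearity, `f` recording the `n` chosen in each row. -/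
theorem det_principal_sum (μ : Fin N → ℝ) (v : Fin N → EuclideanSpace ℝ (Fin N))
    (Y : Finset (Fin N)) :
    (principal (∑ n, μ n • vecMulVec (v n) (v n)) Y).det =
      ∑ f : Y → Fin N, (∏ y, μ (f y)) * minorCoeff v Y f := by
  have h : principal (∑ n, μ n • vecMulVec (v n) (v n)) Y =
      fun (y : Y) => ∑ n, (μ n * v n y) • fun z : Y => v n z := by
    ext y z
    simp [principal, Matrix.sum_apply, vecMulVec_apply, mul_assoc]
  have h2 := (detRowAlternating (R := ℝ) (n := Y)).toMultilinearMap.map_sum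
    (fun (y : Y) (n : Fin N) => (μ n * v n y) • fun z : Y => v n z)
  rw [h]
  refine h2.trans (Finset.sum_congr rfl fun f _ => ?_)
  rw [MultilinearMap.map_smul_univ, minorCoeff, ← mul_assoc, ← Finset.prod_mul_distrib]
  rfl

theorem kernel_selectedVectors (v : Fin N → EuclideanSpace ℝ (Fin N)) (hv : Orthonormal ℝ v)
    (J : Finset (Fin N)) :
    (selectedVectors v hv J).kernel =
      ∑ n, (if n ∈ J then (1 : ℝ) else 0) • vecMulVec (v n) (v n) := by
  rw [OrthonormalSet.kernel, selectedVectors, Finset.sum_map]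
  simp

/-- A form of the Cauchy-Binet formula. -/
theorem det_principal_eq_sum (lam : Fin N → ℝ) (v : Fin N → EuclideanSpace ℝ (Fin N))
    (hv : Orthonormal ℝ v) (Y : Finset (Fin N)) :
    (principal (∑ n, lam n • vecMulVec (v n) (v n)) Y).det =
      ∑ J : Finset (Fin N), if Y.card = J.card then
        (∏ n ∈ J, lam n) * (principal (selectedVectors v hv J).kernel Y).det else 0 := by
  -- The kernel for `J` is the same sum with indicator weights, so both sides expand over the same
  -- `f`. For injective `f`, the only `J` of size `|Y|` containing all its values is its image.
  simp only [kernel_selectedVectors, det_principal_sum]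
  simp only [Finset.mul_sum, ← Finset.sum_filter]
  rw [Finset.sum_comm]
  refine Finset.sum_congr rfl fun f _ => ?_
  by_cases hf : Function.Injective f
  · rw [Finset.sum_eq_single (Finset.univ.image f)]
    · have h1 : ∏ y, (if f y ∈ Finset.univ.image f then (1 : ℝ) else 0) = 1 :=
        Finset.prod_eq_one fun y _ => by simp
      rw [Finset.prod_image hf.injOn, h1, one_mul]
    · intro J hJ hne
      obtain ⟨y, hy⟩ : ∃ y, f y ∉ J := by
        by_contra! h
        refine hne (Finset.eq_of_subset_of_card_le (fun n hn => ?_) ?_).symm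
        · obtain ⟨y, -, rfl⟩ := Finset.mem_image.mp hn
          exact h y
        · rw [Finset.card_image_of_injective _ hf]
          simpa using (Finset.mem_filter.mp hJ).2.ge
      rw [Finset.prod_eq_zero (Finset.mem_univ y) (if_neg hy)]
      simp
    · intro h
      simp [Finset.card_image_of_injective _ hf] at h
  · simp [minorCoeff_eq_zero v Y f hf]

theorem IsEigendecomposition.det_add_one {L : Matrix (Fin N) (Fin N) ℝ} {lam : Fin N → ℝ}
    {v : Fin N → EuclideanSpace ℝ (Fin N)} (h : IsEigendecomposition L lam v) :
    (L + 1).det = ∏ n, (lam n + 1) := by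
  let U : Matrix (Fin N) (Fin N) ℝ := of fun i n => v n i
  have hU : Uᵀ * U = 1 := by
    ext m n
    have := (orthonormal_iff_ite.mp h.orthonormal) n m
    rw [EuclideanSpace.inner_eq_star_dotProduct] at this
    simpa [U, Matrix.mul_apply, dotProduct, Matrix.one_apply, eq_comm] using this
  have hU' : U * Uᵀ = 1 := mul_eq_one_comm.mp hU
  have hL : L = U * diagonal lam * Uᵀ := by
    rw [h.eq_sum]
    ext i j
    rw [Matrix.mul_apply, Matrix.sum_apply]
    refine Finset.sum_congr rfl fun n _ => ?_
    rw [mul_diagonal, Matrix.smul_apply, vecMulVec_apply, smul_eq_mul, transpose_apply]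
    simp only [U, of_apply]
    ring
  have hL1 : L + 1 = U * diagonal (fun n => lam n + 1) * Uᵀ := by
    rw [← diagonal_add lam (fun _ => 1), Matrix.mul_add, Matrix.add_mul, ← hL, diagonal_one,
      Matrix.mul_one, hU']
  rw [hL1, det_mul_right_comm, hU', Matrix.one_mul, det_diagonal]

theorem lEnsembleProb_nonneg {L : Matrix (Fin N) (Fin N) ℝ} (hL : L.PosSemidef)
    (Y : Finset (Fin N)) : 0 ≤ lEnsembleProb L Y :=
  div_nonneg (hL.submatrix _).det_nonneg (hL.add PosSemidef.one).det_nonneg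

/-! ### The law of the first phase -/

/-- The starting set is general for the induction. Each index is visited once, so at each step
exactly one coin value is compatible with the target `J`. -/
theorem firstLoop_apply (c : Fin N → PMF Bool) (l : List (Fin N)) (hl : l.Nodup)
    (J₀ : Finset (Fin N)) (hJ₀ : ∀ n ∈ l, n ∉ J₀) (J : Finset (Fin N)) :
    firstLoop c l J₀ J =
      if ∀ n, n ∉ l → (n ∈ J ↔ n ∈ J₀) then (l.map fun n => c n (decide (n ∈ J))).prod else 0 := by
  induction l generalizing J₀ with
  | nil => simp [firstLoop, PMF.pure_apply, Finset.ext_iff]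
  | cons n l ih =>
    obtain ⟨hn, hl⟩ := List.nodup_cons.mp hl
    have hnJ : n ∉ J₀ := hJ₀ n (by simp)
    have hb : ∀ b : Bool, firstLoop c l (if b then insert n J₀ else J₀) J =
        if decide (n ∈ J) = b then
          if ∀ m, m ∉ n :: l → (m ∈ J ↔ m ∈ J₀) then
            (l.map fun n => c n (decide (n ∈ J))).prod else 0 else 0 := by
      intro b
      rw [ih hl]
      · rw [← ite_and]
        congr 1
        rw [eq_iff_iff]
        constructor
        · intro h
          refine ⟨?_, fun m hm => ?_⟩
          · have := h n hn
            cases b <;> simpa [hnJ] using this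
          · rw [List.mem_cons, not_or] at hm
            have := h m hm.2
            cases b <;> simpa [hm.1] using this
        · rintro ⟨h1, h2⟩ m hm
          by_cases hmn : m = n
          · subst hmn
            cases b <;> simpa [hnJ] using h1
          · have := h2 m (by simp [hm, hmn])
            cases b <;> simpa [hmn] using this
      · intro m hm
        have hmn : m ≠ n := fun h => hn (h ▸ hm)
        have := hJ₀ m (by simp [hm])
        cases b <;> simp [hmn, this]
    rw [firstLoop, PMF.bind_apply, tsum_fintype]
    simp only [hb, mul_ite, mul_zero, Finset.sum_ite_eq, Finset.mem_univ, if_true, List.map_cons,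
      List.prod_cons]

theorem phaseOne_apply (lam : Fin N → ℝ) (hlam : ∀ n, 0 ≤ lam n) (J : Finset (Fin N)) :
    phaseOne lam hlam J = ∏ n, coin (lam n) (hlam n) (decide (n ∈ J)) := by
  rw [phaseOne, firstLoop_apply _ _ (List.nodup_finRange N) _ (by simp), if_pos (by simp),
    Fin.prod_univ_def]

theorem phaseOne_apply_eq_ofReal (lam : Fin N → ℝ) (hlam : ∀ n, 0 ≤ lam n)
    (J : Finset (Fin N)) :
    phaseOne lam hlam J = ENNReal.ofReal ((∏ n ∈ J, lam n) / ∏ n, (lam n + 1)) := by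
  have hpos : ∀ n, 0 < lam n + 1 := fun n => by linarith [hlam n]
  have hc : ∀ n, coin (lam n) (hlam n) (decide (n ∈ J)) =
      ENNReal.ofReal ((if n ∈ J then lam n else 1) / (lam n + 1)) := fun n => by
    by_cases hn : n ∈ J
    · simp [coin, hn]
    · have : 1 - lam n / (lam n + 1) = 1 / (lam n + 1) := by
        have := (hpos n).ne'
        field_simp
        ring
      simp only [coin, hn, PMF.ofFintype_apply, decide_false, Bool.false_eq_true, if_false, this]
  rw [phaseOne_apply, Finset.prod_congr rfl fun n _ => hc n, ← ENNReal.ofReal_prod_of_nonneg,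
    Finset.prod_div_distrib, Finset.prod_ite_mem, Finset.univ_inter]
  intro n _
  have := hlam n
  have := hpos n
  split_ifs <;> positivity

/-- Sets correspond to their indicator functions, which carry the product measure of the coins. -/
theorem sum_phaseOne_card (lam : Fin N → ℝ) (hlam : ∀ n, 0 ≤ lam n) (k : ℕ) :
    ∑ J : Finset (Fin N) with J.card = k, phaseOne lam hlam J =
      MeasureTheory.Measure.pi (fun n => (coin (lam n) (hlam n)).toMeasure)
        {b : Fin N → Bool | ∑ n, (b n).toNat = k} := by
  have hset : {b : Fin N → Bool | ∑ n, (b n).toNat = k} =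
      ((Finset.univ.filter fun b : Fin N → Bool => ∑ n, (b n).toNat = k : Finset _) :
        Set (Fin N → Bool)) := by
    simp
  rw [hset, ← MeasureTheory.sum_measure_singleton]
  have hcard : ∀ J : Finset (Fin N), ∑ n, (decide (n ∈ J)).toNat = J.card := fun J => by
    have h : ∀ n, (decide (n ∈ J)).toNat = if n ∈ J then 1 else 0 := fun n => by
      by_cases hn : n ∈ J <;> simp [hn]
    simp [h]
  have hdec : ∀ b : Fin N → Bool,
      (fun n => decide (n ∈ Finset.univ.filter fun n => b n = true)) = b := fun b => by
    ext n; simp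
  refine Finset.sum_nbij' (fun J n => decide (n ∈ J))
    (fun b => Finset.univ.filter fun n => b n = true) ?_ ?_ ?_ ?_ ?_
  · intro J hJ
    simpa [hcard] using hJ
  · intro b hb
    rw [Finset.mem_filter] at hb ⊢
    rw [← hcard]
    refine ⟨Finset.mem_univ _, ?_⟩
    simpa using hb.2
  · intro J _
    ext n; simp
  · intro b _
    exact hdec b
  · intro J _
    rw [phaseOne_apply, MeasureTheory.Measure.pi_singleton]
    exact Finset.prod_congr rfl fun n _ =>
      ((coin (lam n) (hlam n)).toMeasure_apply_singleton _ (measurableSet_singleton _)).symm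

/-! ### The law of the output -/

theorem card_selectedVectors (v : Fin N → EuclideanSpace ℝ (Fin N)) (hv : Orthonormal ℝ v)
    (J : Finset (Fin N)) : (selectedVectors v hv J).1.card = J.card :=
  Finset.card_map _

theorem card_selectedVectors_le (v : Fin N → EuclideanSpace ℝ (Fin N)) (hv : Orthonormal ℝ v)
    (J : Finset (Fin N)) : (selectedVectors v hv J).1.card ≤ N :=
  (card_selectedVectors v hv J).trans_le (by simpa using Finset.card_le_univ J)

theorem card_of_mem_support_runLoop_selectedVectors
    {perp : OrthonormalSet N → Fin N → OrthonormalSet N} (hperp : IsPerpRule perp)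
    (v : Fin N → EuclideanSpace ℝ (Fin N)) (hv : Orthonormal ℝ v) (J : Finset (Fin N))
    (r : State N) (hr : r ∈ (runLoop perp N ⟨selectedVectors v hv J, ∅⟩).support) :
    r.V.1.card = 0 ∧ r.Y.card = J.card := by
  have := card_of_mem_support_runLoop hperp N ⟨selectedVectors v hv J, ∅⟩
    (card_selectedVectors_le v hv J) (by simp) r hr
  simpa [card_selectedVectors] using this

theorem stateAfter_stopped (lam : Fin N → ℝ) (hlam : ∀ n, 0 ≤ lam n)
    (v : Fin N → EuclideanSpace ℝ (Fin N)) (hv : Orthonormal ℝ v)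
    (perp : OrthonormalSet N → Fin N → OrthonormalSet N) (t : ℕ) (Y : Finset (Fin N)) :
    (stateAfter lam hlam v hv perp t).toOuterMeasure {r | r.V.1.card = 0 ∧ r.Y = Y} =
      ∑ J, phaseOne lam hlam J * (runLoop perp t ⟨selectedVectors v hv J, ∅⟩).toOuterMeasure
        {r | r.V.1.card = 0 ∧ r.Y = Y} := by
  rw [stateAfter, PMF.toOuterMeasure_bind_apply, tsum_fintype]

/-- The algorithm has produced its output after `N` passes. -/
theorem outputProb_eq_sum (lam : Fin N → ℝ) (hlam : ∀ n, 0 ≤ lam n)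
    (v : Fin N → EuclideanSpace ℝ (Fin N)) (hv : Orthonormal ℝ v)
    {perp : OrthonormalSet N → Fin N → OrthonormalSet N} (hperp : IsPerpRule perp)
    (Y : Finset (Fin N)) :
    outputProb lam hlam v hv perp Y =
      ∑ J, phaseOne lam hlam J * (runLoop perp N ⟨selectedVectors v hv J, ∅⟩).toOuterMeasure
        {r | r.V.1.card = 0 ∧ r.Y = Y} := by
  simp only [outputProb, stateAfter_stopped]
  refine le_antisymm (iSup_le fun t => Finset.sum_le_sum fun J _ => mul_le_mul_right ?_ _)
    (le_iSup (fun t => ∑ J, phaseOne lam hlam J *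
      (runLoop perp t ⟨selectedVectors v hv J, ∅⟩).toOuterMeasure
        {r | r.V.1.card = 0 ∧ r.Y = Y}) N)
  have hN := card_selectedVectors_le v hv J
  -- Both `t + N` and `N` passes are enough to stop, and the closed formula does not involve the
  -- number of passes.
  refine (runLoop_mono perp Y _ (Nat.le_add_right t N)).trans_eq ?_
  simp only
  rw [runLoop_stopped hperp Y (t + N) ⟨selectedVectors v hv J, ∅⟩ (by simp only; omega) (by simp),
    runLoop_stopped hperp Y N ⟨selectedVectors v hv J, ∅⟩ hN (by simp)]

theorem outputProb_eq_lEnsembleProb {L : Matrix (Fin N) (Fin N) ℝ} {lam : Fin N → ℝ}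
    (hlam : ∀ n, 0 ≤ lam n) {v : Fin N → EuclideanSpace ℝ (Fin N)}
    (hdec : IsEigendecomposition L lam v) {perp : OrthonormalSet N → Fin N → OrthonormalSet N}
    (hperp : IsPerpRule perp) (Y : Finset (Fin N)) :
    outputProb lam hlam v hdec.orthonormal perp Y = ENNReal.ofReal (lEnsembleProb L Y) := by
  have hw : ∀ J : Finset (Fin N), 0 ≤ (∏ n ∈ J, lam n) / ∏ n, (lam n + 1) := fun J =>
    div_nonneg (Finset.prod_nonneg fun n _ => hlam n)
      (Finset.prod_nonneg fun n _ => by linarith [hlam n])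
  have hdet : lEnsembleProb L Y = ∑ J : Finset (Fin N), if Y.card = J.card then
      (∏ n ∈ J, lam n) / (∏ n, (lam n + 1)) *
        (principal (selectedVectors v hdec.orthonormal J).kernel Y).det else 0 := by
    rw [lEnsembleProb, hdec.det_add_one, congrArg (fun M => (principal M Y).det) hdec.eq_sum,
      det_principal_eq_sum lam v hdec.orthonormal, Finset.sum_div]
    refine Finset.sum_congr rfl fun J _ => ?_
    rw [ite_div, zero_div, div_mul_eq_mul_div]
  rw [outputProb_eq_sum lam hlam v hdec.orthonormal hperp, hdet, ENNReal.ofReal_sum_of_nonneg]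
  · refine Finset.sum_congr rfl fun J _ => ?_
    rw [runLoop_stopped hperp Y N ⟨selectedVectors v hdec.orthonormal J, ∅⟩
      (card_selectedVectors_le v hdec.orthonormal J)
      (by simp), phaseOne_apply_eq_ofReal]
    simp only [Finset.empty_subset, true_and, card_selectedVectors]
    rw [Finset.sdiff_empty]
    split_ifs
    · rw [ENNReal.ofReal_mul (hw J)]
    · simp
  · intro J _
    split_ifs
    · exact mul_nonneg (hw J) (det_kernel_nonneg _ _)
    · exact le_rfl

/-- Given `J`, every reachable final state has exactly `|J|` items, so the size of the output is
deterministic. -/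
theorem sum_runLoop_card {perp : OrthonormalSet N → Fin N → OrthonormalSet N}
    (hperp : IsPerpRule perp) (v : Fin N → EuclideanSpace ℝ (Fin N)) (hv : Orthonormal ℝ v)
    (J : Finset (Fin N)) (k : ℕ) :
    ∑ Y : Finset (Fin N) with Y.card = k,
      (runLoop perp N ⟨selectedVectors v hv J, ∅⟩).toOuterMeasure
        {r | r.V.1.card = 0 ∧ r.Y = Y} = if J.card = k then 1 else 0 := by
  set p := runLoop perp N ⟨selectedVectors v hv J, ∅⟩
  have hp : ∀ r ∈ p.support, r.V.1.card = 0 ∧ r.Y.card = J.card :=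
    card_of_mem_support_runLoop_selectedVectors hperp v hv J
  have hY : ∀ Y, p.toOuterMeasure {r | r.V.1.card = 0 ∧ r.Y = Y} = p.map State.Y Y := by
    intro Y
    rw [← PMF.toOuterMeasure_apply_singleton, PMF.toOuterMeasure_map_apply]
    refine PMF.toOuterMeasure_apply_eq_of_inter_support_eq _ ?_
    ext r
    constructor
    · rintro ⟨h1, h2⟩
      exact ⟨h1.2, h2⟩
    · rintro ⟨h1, h2⟩
      exact ⟨⟨(hp r h2).1, h1⟩, h2⟩
  rw [Finset.sum_congr rfl fun Y _ => hY Y, ← PMF.toOuterMeasure_apply_finset]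
  split_ifs with h
  · rw [PMF.toOuterMeasure_apply_eq_one_iff]
    intro Y hY
    obtain ⟨r, hr, rfl⟩ := (PMF.mem_support_map_iff _ _ _).mp hY
    simp [(hp r hr).2, h]
  · rw [PMF.toOuterMeasure_apply_eq_zero_iff, Set.disjoint_left]
    intro Y hY
    obtain ⟨r, hr, rfl⟩ := (PMF.mem_support_map_iff _ _ _).mp hY
    simp [(hp r hr).2, h]

theorem sum_outputProb_card (lam : Fin N → ℝ) (hlam : ∀ n, 0 ≤ lam n)
    (v : Fin N → EuclideanSpace ℝ (Fin N)) (hv : Orthonormal ℝ v)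
    {perp : OrthonormalSet N → Fin N → OrthonormalSet N} (hperp : IsPerpRule perp) (k : ℕ) :
    ∑ Y : Finset (Fin N) with Y.card = k, outputProb lam hlam v hv perp Y =
      ∑ J : Finset (Fin N) with J.card = k, phaseOne lam hlam J := by
  simp only [outputProb_eq_sum lam hlam v hv hperp]
  rw [Finset.sum_comm]
  simp only [← Finset.mul_sum, sum_runLoop_card hperp, mul_ite, mul_one, mul_zero,
    ← Finset.sum_filter]

theorem card_of_mem_support_stateAfter (lam : Fin N → ℝ) (hlam : ∀ n, 0 ≤ lam n)
    (v : Fin N → EuclideanSpace ℝ (Fin N)) (hv : Orthonormal ℝ v)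
    {perp : OrthonormalSet N → Fin N → OrthonormalSet N} (hperp : IsPerpRule perp) :
    ∀ s ∈ (stateAfter lam hlam v hv perp N).support, s.V.1.card = 0 := by
  intro s hs
  obtain ⟨J, -, hs⟩ := (PMF.mem_support_bind_iff _ _ _).mp hs
  exact (card_of_mem_support_runLoop_selectedVectors hperp v hv J s hs).1

end DPP

theorem mainTheorem1 (N : ℕ) (L : Matrix (Fin N) (Fin N) ℝ) (hL : L.PosSemidef)
    (lam : Fin N → ℝ) (v : Fin N → EuclideanSpace ℝ (Fin N))
    (hdec : DPP.IsEigendecomposition L lam v)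
    (perp : DPP.OrthonormalSet N → Fin N → DPP.OrthonormalSet N) (hperp : DPP.IsPerpRule perp) :
    -- the second loop stops after at most `N` passes
    (∀ s ∈ (DPP.stateAfter lam (hdec.nonneg hL) v hdec.orthonormal perp N).support,
      s.V.1.card = 0) ∧
    -- the output is distributed according to the L-ensemble
    (∀ Y : Finset (Fin N), 0 ≤ DPP.lEnsembleProb L Y ∧
      DPP.outputProb lam (hdec.nonneg hL) v hdec.orthonormal perp Y =
        ENNReal.ofReal (DPP.lEnsembleProb L Y)) ∧
    -- the cardinality of the output is distributed as a sum of independent Bernoulli variables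
    (∀ k : ℕ, ∑ Y : Finset (Fin N) with Y.card = k,
        DPP.outputProb lam (hdec.nonneg hL) v hdec.orthonormal perp Y =
      MeasureTheory.Measure.pi
        (fun n => (DPP.coin (lam n) (hdec.nonneg hL n)).toMeasure)
        {b : Fin N → Bool | ∑ n, (b n).toNat = k}) :=
  ⟨DPP.card_of_mem_support_stateAfter lam _ v _ hperp,
    fun Y => ⟨DPP.lEnsembleProb_nonneg hL Y, DPP.outputProb_eq_lEnsembleProb _ hdec hperp Y⟩,
    fun k => (DPP.sum_outputProb_card lam _ v _ hperp k).trans (DPP.sum_phaseOne_card lam _ k)⟩
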